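/- There is an absolute constant $\delta>0$ such that the following holds for all $a,b,c\in\mathbb C$ with $0<|a|,|b|,|c|<\delta$, $|c|<\delta|a|$, $|b|<\delta|a|$ and $|ab|<\delta|c|$. Let $F:\mathbb C^2\to\mathbb C^2$, $F(z,w)=(az+z^2,\;w^2+cw+bz)$, and let $\Omega$ be the immediate basin of attraction of the fixed point $(0,0)$, i.e. the connected component containing $(0,0)$ of $\{x\in\mathbb C^2: F^n(x)\to(0,0)\}$. Then the backward orbit $\bigcup_{k\ge 0}F^{-k}(0,0)$ is contained in $\Omega$, and for every constant $C>0$ there is a point $(z_0,0)\in\Omega$ such that $d_\Omega\big((z_0,0),(\tilde z,\tilde w)\big)\ge C$ for every $(\tilde z,\tilde w)\in\bigcup_{k\ge0}F^{-k}(0,0)$. Here $d_\Omega$ is the Kobayashi distance: with $\triangle$ the unit disc and $K_\Omega(p,\xi)=\inf\{\lambda>0:\exists f:\triangle\to\Omega \text{ holomorphic},\ f(0)=p,\ \lambda f'(0)=\xi\}$, $d_\Omega(p,q)$ is the infimum of $\int_0^1K_\Omega(\gamma(t),\gamma'(t))\,dt$ over all piecewise smooth curves $\gamma:[0,1]\to\Omega$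 from $p$ to $q$. -/

import Mathlib

open Set Filter Topology
open scoped ENNReal ContDiff

/-- The Kobayashi (infinitesimal) metric of `Ω ⊆ ℂ²` at `p` in the direction `ξ`: the infimum of
the `r > 0` for which some holomorphic `f` from the unit disc to `Ω` has `f 0 = p` and
`r • f' 0 = ξ`. -/
noncomputable def kobayashiMetric (Ω : Set (ℂ × ℂ)) (p ξ : ℂ × ℂ) : ℝ≥0∞ :=
  ⨅ (r : ℝ) (_ : 0 < r) (_ : ∃ f : ℂ → ℂ × ℂ,
      DifferentiableOn ℂ f (Metric.ball 0 1) ∧ MapsTo f (Metric.ball 0 1) Ω ∧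
      f 0 = p ∧ r • deriv f 0 = ξ), ENNReal.ofReal r

/-- `γ` restricted to `[0, 1]` is a piecewise smooth curve: it is continuous, and smooth on each
closed interval of a finite partition of `[0, 1]`. -/
def IsPiecewiseSmooth (γ : ℝ → ℂ × ℂ) : Prop :=
  ContinuousOn γ (Icc 0 1) ∧
  ∃ (n : ℕ) (t : Fin (n + 1) → ℝ), StrictMono t ∧ t 0 = 0 ∧ t (Fin.last n) = 1 ∧
    ∀ i : Fin n, ContDiffOn ℝ ∞ γ (Icc (t i.castSucc) (t i.succ))

/-- The Kobayashi length of a curve parametrized by `[0, 1]`. -/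
noncomputable def kobayashiLength (Ω : Set (ℂ × ℂ)) (γ : ℝ → ℂ × ℂ) : ℝ≥0∞ :=
  ∫⁻ t in Icc (0 : ℝ) 1, kobayashiMetric Ω (γ t) (deriv γ t)

/-- The Kobayashi distance: the infimum of the Kobayashi lengths of the piecewise smooth curves
in `Ω` from `p` to `q` (it is `⊤` when there is no such curve). -/
noncomputable def kobayashiDist (Ω : Set (ℂ × ℂ)) (p q : ℂ × ℂ) : ℝ≥0∞ :=
  ⨅ (γ : ℝ → ℂ × ℂ) (_ : IsPiecewiseSmooth γ ∧ MapsTo γ (Icc 0 1) Ω ∧ γ 0 = p ∧ γ 1 = q),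
    kobayashiLength Ω γ

/-- The basin of attraction of `p` under `F`. -/
def basin (F : ℂ × ℂ → ℂ × ℂ) (p : ℂ × ℂ) : Set (ℂ × ℂ) :=
  {x | Tendsto (fun n : ℕ => F^[n] x) atTop (𝓝 p)}

/-- The immediate basin: the connected component of the basin of attraction containing `p`. -/
def immediateBasin (F : ℂ × ℂ → ℂ × ℂ) (p : ℂ × ℂ) : Set (ℂ × ℂ) :=
  connectedComponentIn (basin F p) p

/-- The backward orbit `⋃ k ≥ 0, F⁻ᵏ(p)`. -/
def backwardOrbit (F : ℂ × ℂ → ℂ × ℂ) (p : ℂ × ℂ) : Set (ℂ × ℂ) :=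
  ⋃ k : ℕ, F^[k] ⁻¹' {p}

/-- The polynomial skew product `F(z, w) = (a z + z², w² + c w + b z)`. -/
def skewMap (a b c : ℂ) (x : ℂ × ℂ) : ℂ × ℂ :=
  (a * x.1 + x.1 ^ 2, x.2 ^ 2 + c * x.2 + b * x.1)

/-!
A holomorphic map from `Ω` to the punctured unit disc does not increase Kobayashi distances, so if
it takes values of very different sizes at two points, one of them close to the puncture, then
these points are far apart. Fix a boundary point `β` of the basin of `z ↦ a z + z²` and take
`(z₀, 0)` with `z₀` very close to `β`. A point `q` of the backward orbit with first coordinate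
away from `β` is far from `(z₀, 0)` because `z - β` has no zero on `Ω`. If the first coordinate of
`q` is close to `β`, it stays away from `0` for a long time. If moreover the second coordinate
became small during that time, it would shrink to the size of `b` and from then on be
dominated by the term `b z`; the orbit would then enter the fibre `z = 0` through `z = -a`, at a
height `w` with `0 < |w| < |c|`, from where it cannot reach the origin. So the second coordinate of
`q` stays large for `n` steps. Pulling the line `w = 2` back `n` times then yields a holomorphic
graph `w = σ(z)` that misses `Ω` and passes within `4 (5/6)ⁿ` of `q`, while `|σ(z₀)|` is bounded
below, and the function `σ(z) - w` separates `(z₀, 0)` from `q`.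
-/

section PuncturedDisc

open Metric

theorem exists_differentiableOn_exp_eq {h : ℂ → ℂ} {c : ℂ} {R : ℝ}
    (hd : DifferentiableOn ℂ h (ball c R)) (h0 : ∀ z ∈ ball c R, h z ≠ 0) :
    ∃ g : ℂ → ℂ, DifferentiableOn ℂ g (ball c R) ∧ ∀ z ∈ ball c R, Complex.exp (g z) = h z := by
  obtain ⟨g, hgc, hg⟩ :=
    ((hd.deriv isOpen_ball).div hd h0).isExactOn_ball.with_val_at c (Complex.log (h c))
  refine ⟨g, fun z hz => (hg z hz).differentiableAt.differentiableWithinAt, fun z hz => ?_⟩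
  have hder : ∀ y ∈ ball c R, HasDerivAt (fun y => h y * Complex.exp (-g y)) 0 y := by
    intro y hy
    have hhy := (hd.differentiableAt (isOpen_ball.mem_nhds hy)).hasDerivAt
    refine (hhy.mul (hg y hy).neg.cexp).congr_deriv ?_
    have := h0 y hy
    simp only [Pi.div_apply]
    field_simp
    ring
  have hc : c ∈ ball c R := mem_ball_self (pos_of_mem_ball hz)
  have hconst : h z * Complex.exp (-g z) = h c * Complex.exp (-g c) :=
    isOpen_ball.is_const_of_deriv_eq_zero (convex_ball c R).isPreconnected
      (fun y hy => (hder y hy).differentiableAt.differentiableWithinAt)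
      (fun y hy => (hder y hy).deriv) hz hc
  rw [hgc, Complex.exp_neg, Complex.exp_neg, Complex.exp_log (h0 c hc), mul_inv_cancel₀ (h0 c hc),
    mul_inv_eq_one₀ (Complex.exp_ne_zero _)] at hconst
  exact hconst.symm

theorem norm_deriv_zero_le_of_re_lt {g : ℂ → ℂ} {R M : ℝ} (hR : 0 < R)
    (hd : DifferentiableOn ℂ g (ball 0 R)) (hM : MapsTo g (ball 0 R) {w | w.re < M}) :
    ‖deriv g 0‖ ≤ 2 * (M - (g 0).re) / R := by
  have h0 : (0 : ℂ) ∈ ball (0 : ℂ) R := mem_ball_self hR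
  have hBC : ∀ z ∈ ball (0 : ℂ) R, ‖g z - g 0‖ ≤ 2 * (M - (g 0).re) * ‖z‖ / (R - ‖z‖) := by
    intro z hz
    refine Complex.borelCaratheodory_zero (f := fun z => g z - g 0) (sub_pos.mpr (hM h0))
      (hd.sub_const _) (fun y hy => ?_) hR hz (sub_self _)
    simpa using (hM hy).le
  have hslope : Tendsto (fun z => ‖slope g 0 z‖) (𝓝[≠] 0) (𝓝 ‖deriv g 0‖) :=
    (hasDerivAt_iff_tendsto_slope.mp
      (hd.differentiableAt (isOpen_ball.mem_nhds h0)).hasDerivAt).norm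
  have hlim : Tendsto (fun z : ℂ => 2 * (M - (g 0).re) / (R - ‖z‖)) (𝓝[≠] 0)
      (𝓝 (2 * (M - (g 0).re) / R)) := by
    have : ContinuousAt (fun z : ℂ => 2 * (M - (g 0).re) / (R - ‖z‖)) 0 :=
      continuousAt_const.div (by fun_prop) (by simpa using hR.ne')
    simpa using this.tendsto.mono_left nhdsWithin_le_nhds
  refine le_of_tendsto_of_tendsto hslope hlim ?_
  filter_upwards [self_mem_nhdsWithin, nhdsWithin_le_nhds (isOpen_ball.mem_nhds h0)] with z hz hzR
  have hz0 : 0 < ‖z‖ := norm_pos_iff.mpr hz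
  rw [slope_def_field, sub_zero, norm_div, div_le_iff₀ hz0, div_mul_eq_mul_div]
  exact hBC z hzR

theorem norm_deriv_zero_le_of_mapsTo_ball_diff_zero {h : ℂ → ℂ} {R : ℝ} (hR : 0 < R)
    (hd : DifferentiableOn ℂ h (ball 0 R)) (hm : MapsTo h (ball 0 R) (ball 0 1 \ {0})) :
    ‖deriv h 0‖ ≤ 2 * ‖h 0‖ * -Real.log ‖h 0‖ / R := by
  have h0 : (0 : ℂ) ∈ ball (0 : ℂ) R := mem_ball_self hR
  obtain ⟨g, hg, hexp⟩ := exists_differentiableOn_exp_eq hd fun z hz => (hm hz).2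
  have hre : ∀ z ∈ ball (0 : ℂ) R, (g z).re = Real.log ‖h z‖ := fun z hz => by
    rw [← hexp z hz, Complex.norm_exp, Real.log_exp]
  have hneg : MapsTo g (ball 0 R) {w | w.re < 0} := fun z hz => by
    rw [mem_ofPred_eq, hre z hz]
    exact Real.log_neg (norm_pos_iff.mpr (hm hz).2) (mem_ball_zero_iff.mp (hm hz).1)
  have hder : deriv h 0 = h 0 * deriv g 0 := by
    rw [(EqOn.eventuallyEq_of_mem hexp (isOpen_ball.mem_nhds h0)).symm.deriv_eq,
      deriv_cexp (hg.differentiableAt (isOpen_ball.mem_nhds h0)), hexp 0 h0]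
  calc ‖deriv h 0‖ = ‖h 0‖ * ‖deriv g 0‖ := by rw [hder, norm_mul]
    _ ≤ ‖h 0‖ * (2 * (0 - (g 0).re) / R) := by
        gcongr
        exact norm_deriv_zero_le_of_re_lt hR hg hneg
    _ = 2 * ‖h 0‖ * -Real.log ‖h 0‖ / R := by rw [hre 0 h0]; ring

/-- Half of this function is `1`-Lipschitz for the hyperbolic metric
`|dw| / (2 |w| (-log |w|))` of the punctured unit disc, and it tends to `∞` at the puncture. -/
noncomputable def cuspHeight (w : ℂ) : ℝ := Real.log (-Real.log ‖w‖)

theorem neg_log_norm_pos {w : ℂ} (hw : w ∈ ball (0 : ℂ) 1 \ {0}) : 0 < -Real.log ‖w‖ :=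
  neg_pos.mpr (Real.log_neg (norm_pos_iff.mpr hw.2) (mem_ball_zero_iff.mp hw.1))

theorem continuousOn_cuspHeight : ContinuousOn cuspHeight (ball 0 1 \ {0}) :=
  (continuousOn_id.norm.log fun _ hw => norm_ne_zero_iff.mpr hw.2).neg.log
    fun _ hw => (neg_log_norm_pos hw).ne'

theorem exists_hasDerivAt_cuspHeight_comp {h : ℝ → ℂ} {h' : ℂ} {t : ℝ} (hd : HasDerivAt h h' t)
    (ht : h t ∈ ball (0 : ℂ) 1 \ {0}) :
    ∃ d : ℝ, HasDerivAt (fun t => cuspHeight (h t)) d t ∧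
      |d| ≤ ‖h'‖ / (‖h t‖ * -Real.log ‖h t‖) := by
  have hpos : 0 < ‖h t‖ := norm_pos_iff.mpr ht.2
  have hlog := neg_log_norm_pos ht
  have hn : HasDerivAt (fun t => ‖h t‖) (inner ℝ (h t) h' / ‖h t‖) t := by
    have := hd.norm_sq.sqrt (pow_ne_zero 2 hpos.ne')
    simp only [Real.sqrt_sq (norm_nonneg _)] at this
    exact this.congr_deriv (mul_div_mul_left _ _ two_ne_zero)
  refine ⟨_, (hn.log hpos.ne').neg.log hlog.ne', ?_⟩
  have hinner : |inner ℝ (h t) h'| / ‖h t‖ ≤ ‖h'‖ := by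
    rw [div_le_iff₀ hpos, mul_comm]
    exact abs_real_inner_le_norm _ _
  rw [Pi.neg_apply, abs_div, abs_neg, abs_div, abs_div, abs_of_pos hpos, abs_of_pos hlog,
    div_div (_ / ‖h t‖)]
  gcongr

theorem le_cuspHeight_sub_cuspHeight {w w' : ℂ} {C ε : ℝ} (hε : 0 < ε) (hw : ε ≤ ‖w‖)
    (hw1 : ‖w‖ < 1) (h0 : w' ≠ 0) (hw' : ‖w'‖ ≤ Real.exp (-(Real.exp C / ε))) :
    C ≤ cuspHeight w' - cuspHeight w := by
  have hlog : -Real.log ‖w‖ ≤ ε⁻¹ := by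
    rw [← Real.log_inv]
    refine (Real.log_le_self (by positivity)).trans ?_
    gcongr
  have hlog' : Real.exp C / ε ≤ -Real.log ‖w'‖ := by
    rw [le_neg, ← Real.log_exp (-(Real.exp C / ε))]
    exact Real.log_le_log (norm_pos_iff.mpr h0) hw'
  have hpos : 0 < -Real.log ‖w‖ := neg_pos.mpr (Real.log_neg (hε.trans_le hw) hw1)
  have hpos' : 0 < -Real.log ‖w'‖ := (by positivity : 0 < Real.exp C / ε).trans_le hlog'
  rw [cuspHeight, cuspHeight, ← Real.log_div hpos'.ne' hpos.ne',
    Real.le_log_iff_exp_le (div_pos hpos' hpos), le_div_iff₀ hpos]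
  exact (mul_le_mul_of_nonneg_left hlog (Real.exp_pos C).le).trans hlog'

end PuncturedDisc

theorem enorm_sub_le_lintegral_of_hasDerivAt_off_countable {E : Type*} [NormedAddCommGroup E]
    [NormedSpace ℝ E] [CompleteSpace E] {f : ℝ → E} {k : ℝ → ℝ≥0∞} {a b : ℝ} {s : Set ℝ}
    (hab : a ≤ b) (hs : s.Countable) (hc : ContinuousOn f (Icc a b))
    (hd : ∀ t ∈ Ioo a b \ s, ∃ d, HasDerivAt f d t ∧ ‖d‖ₑ ≤ k t) :
    ‖f b - f a‖ₑ ≤ ∫⁻ t in Icc a b, k t := by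
  have hle : ∫⁻ t in Ioc a b, ‖deriv f t‖ₑ ≤ ∫⁻ t in Ioc a b, k t := by
    refine MeasureTheory.lintegral_mono_ae ?_
    rw [MeasureTheory.ae_restrict_iff' measurableSet_Ioc]
    filter_upwards [(hs.insert b).ae_notMem MeasureTheory.volume] with t hts ht
    rw [mem_insert_iff, not_or] at hts
    obtain ⟨d, hd, hdk⟩ := hd t ⟨⟨ht.1, lt_of_le_of_ne ht.2 hts.1⟩, hts.2⟩
    rwa [hd.deriv]
  rw [MeasureTheory.restrict_Ioc_eq_restrict_Icc] at hle
  refine le_trans ?_ hle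
  rcases eq_or_ne (∫⁻ t in Icc a b, ‖deriv f t‖ₑ) ⊤ with htop | hfin
  · exact htop ▸ le_top
  have hint : MeasureTheory.IntegrableOn (deriv f) (Icc a b) :=
    ⟨(stronglyMeasurable_deriv f).aestronglyMeasurable, hfin.lt_top⟩
  have hftc := MeasureTheory.integral_eq_of_hasDerivAt_off_countable_of_le f (deriv f) hab hs hc
    (fun t ht => (hd t ht).choose_spec.1.differentiableAt.hasDerivAt)
    ((intervalIntegrable_iff_integrableOn_Icc_of_le hab).mpr hint)
  rw [← hftc, intervalIntegral.integral_of_le hab, ← MeasureTheory.integral_Icc_eq_integral_Ioc]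
  exact MeasureTheory.enorm_integral_le_lintegral_enorm _

theorem IsPiecewiseSmooth.exists_countable_differentiableAt {γ : ℝ → ℂ × ℂ}
    (hγ : IsPiecewiseSmooth γ) :
    ∃ s : Set ℝ, s.Countable ∧ ∀ t ∈ Ioo (0 : ℝ) 1 \ s, DifferentiableAt ℝ γ t := by
  obtain ⟨-, n, t, -, ht0, ht1, hsmooth⟩ := hγ
  refine ⟨range t, countable_range t, ?_⟩
  rintro x ⟨⟨hx0, hx1⟩, hxt⟩
  obtain ⟨i, hi, hi'⟩ : ∃ i : Fin n, t i.castSucc < x ∧ x < t i.succ := by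
    by_contra! hcon
    have hlt : ∀ i : Fin (n + 1), t i < x := fun i => by
      induction i using Fin.induction with
      | zero => rwa [ht0]
      | succ i ih => exact lt_of_le_of_ne (hcon i ih) fun h => hxt ⟨_, h⟩
    exact (hlt (Fin.last n)).not_gt (ht1 ▸ hx1)
  exact ((hsmooth i).differentiableOn (by simp)).differentiableAt (Icc_mem_nhds hi hi')

section KobayashiLowerBound

open Metric

variable {Ω : Set (ℂ × ℂ)} {φ : ℂ × ℂ → ℂ}

theorem ofReal_norm_fderiv_div_le_kobayashiMetric (hd : ∀ p ∈ Ω, DifferentiableAt ℂ φ p)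
    (hm : MapsTo φ Ω (ball 0 1 \ {0})) (p ξ : ℂ × ℂ) :
    ENNReal.ofReal (‖fderiv ℂ φ p ξ‖ / (2 * (‖φ p‖ * -Real.log ‖φ p‖))) ≤
      kobayashiMetric Ω p ξ := by
  refine le_iInf fun r => le_iInf fun hr => le_iInf ?_
  rintro ⟨f, hf, hfΩ, rfl, rfl⟩
  have h0 : (0 : ℂ) ∈ ball (0 : ℂ) 1 := mem_ball_self one_pos
  have hdf : ∀ z ∈ ball (0 : ℂ) 1, DifferentiableAt ℂ f z :=
    fun z hz => hf.differentiableAt (isOpen_ball.mem_nhds hz)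
  have hderiv : deriv (φ ∘ f) 0 = fderiv ℂ φ (f 0) (deriv f 0) :=
    fderiv_comp_deriv 0 (hd _ (hfΩ h0)) (hdf 0 h0)
  have hschwarz : ‖fderiv ℂ φ (f 0) (deriv f 0)‖ ≤ 2 * (‖φ (f 0)‖ * -Real.log ‖φ (f 0)‖) := by
    rw [← hderiv, ← mul_assoc, ← div_one (_ * _)]
    exact norm_deriv_zero_le_of_mapsTo_ball_diff_zero one_pos
      (fun z hz => ((hd _ (hfΩ hz)).comp z (hdf z hz)).differentiableWithinAt) (hm.comp hfΩ)
  have hpos : 0 < ‖φ (f 0)‖ := norm_pos_iff.mpr (hm (hfΩ h0)).2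
  have hlog := neg_log_norm_pos (hm (hfΩ h0))
  have hsmul : fderiv ℂ φ (f 0) (r • deriv f 0) = r • fderiv ℂ φ (f 0) (deriv f 0) :=
    ((fderiv ℂ φ (f 0)).restrictScalars ℝ).map_smul r _
  rw [hsmul, norm_smul, Real.norm_of_nonneg hr.le]
  apply ENNReal.ofReal_le_ofReal
  rw [div_le_iff₀ (by positivity)]
  exact mul_le_mul_of_nonneg_left hschwarz hr.le

theorem exists_hasDerivAt_half_cuspHeight_comp (hd : ∀ p ∈ Ω, DifferentiableAt ℂ φ p)
    (hm : MapsTo φ Ω (ball 0 1 \ {0})) {γ : ℝ → ℂ × ℂ} {γ' : ℂ × ℂ} {t : ℝ}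
    (hγ : HasDerivAt γ γ' t) (ht : γ t ∈ Ω) :
    ∃ d : ℝ, HasDerivAt (fun t => cuspHeight (φ (γ t)) / 2) d t ∧
      ‖d‖ₑ ≤ kobayashiMetric Ω (γ t) γ' := by
  obtain ⟨d, hder, hle⟩ := exists_hasDerivAt_cuspHeight_comp
    (((hd _ ht).hasFDerivAt.restrictScalars ℝ).comp_hasDerivAt t hγ) (hm ht)
  refine ⟨d / 2, hder.div_const 2,
    le_trans ?_ (ofReal_norm_fderiv_div_le_kobayashiMetric hd hm _ _)⟩
  rw [← ofReal_norm, Real.norm_eq_abs, abs_div, abs_two, mul_comm 2, ← div_div]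
  gcongr
  exact hle

theorem ofReal_abs_cuspHeight_sub_le_kobayashiDist (hd : ∀ p ∈ Ω, DifferentiableAt ℂ φ p)
    (hm : MapsTo φ Ω (ball 0 1 \ {0})) (p q : ℂ × ℂ) :
    ENNReal.ofReal (|cuspHeight (φ q) - cuspHeight (φ p)| / 2) ≤ kobayashiDist Ω p q := by
  refine le_iInf fun γ => le_iInf ?_
  rintro ⟨hγ, hγΩ, rfl, rfl⟩
  obtain ⟨s, hs, hdiff⟩ := hγ.exists_countable_differentiableAt
  have hφγ : ContinuousOn (fun t => φ (γ t)) (Icc 0 1) :=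
    ContinuousOn.comp (fun p hp => (hd p hp).continuousAt.continuousWithinAt) hγ.1 hγΩ
  have hvar := enorm_sub_le_lintegral_of_hasDerivAt_off_countable
    (k := fun t => kobayashiMetric Ω (γ t) (deriv γ t)) zero_le_one hs
    ((continuousOn_cuspHeight.comp hφγ (hm.comp hγΩ)).div_const 2)
    fun t ht => exists_hasDerivAt_half_cuspHeight_comp hd hm (hdiff t ht).hasDerivAt
      (hγΩ (Ioo_subset_Icc_self ht.1))
  rwa [← sub_div, ← ofReal_norm, Real.norm_eq_abs, abs_div, abs_two] at hvar

end KobayashiLowerBound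

section OpenClosedMap

variable {X Y : Type*} [TopologicalSpace X] [TopologicalSpace Y] {f : X → Y}

theorem preconnectedSpace_of_fiber_subset [PreconnectedSpace Y] (ho : IsOpenMap f)
    (hc : IsClosedMap f) {y : Y} {S : Set X} (hS : IsPreconnected S) (hy : f ⁻¹' {y} ⊆ S) :
    PreconnectedSpace X := by
  -- If `S` misses the clopen set `A`, then the clopen set `f '' A` misses `y`, hence is empty.
  have hempty : ∀ A : Set X, IsClopen A → Disjoint S A → A = ∅ := fun A hA hSA => by
    rcases isClopen_iff.mp ⟨hc A hA.1, ho A hA.2⟩ with h | h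
    · exact image_eq_empty.mp h
    · obtain ⟨x, hxA, hxy⟩ := h.symm ▸ mem_univ y
      exact absurd hxA (disjoint_left.mp hSA (hy hxy))
  rw [preconnectedSpace_iff_clopen]
  intro A hA
  rcases disjoint_or_nonempty_inter S A with h | h
  · exact .inl (hempty A hA h)
  · exact .inr (compl_empty_iff.mp
      (hempty Aᶜ hA.compl (disjoint_compl_right_iff_subset.mpr (hS.subset_isClopen hA h))))

theorem isPreconnected_preimage_of_fiber_subset (ho : IsOpenMap f) (hc : IsClosedMap f)
    {V : Set Y} (hV : IsPreconnected V) {y : Y} (hyV : y ∈ V) {S : Set X} (hS : IsPreconnected S)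
    (hSV : S ⊆ f ⁻¹' V) (hy : f ⁻¹' {y} ⊆ S) : IsPreconnected (f ⁻¹' V) := by
  have : PreconnectedSpace V := isPreconnected_iff_preconnectedSpace.mp hV
  rw [isPreconnected_iff_preconnectedSpace]
  refine preconnectedSpace_of_fiber_subset (f := V.restrictPreimage f) (y := ⟨y, hyV⟩)
    (S := Subtype.val ⁻¹' S) (ho.restrictPreimage V) (hc.restrictPreimage V) ?_
    fun x hx => hy (congrArg Subtype.val hx)
  rwa [← IsInducing.subtypeVal.isPreconnected_image, Subtype.image_preimage_coe,
    inter_eq_right.mpr hSV]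

end OpenClosedMap

/-- The basin of attraction of `p` under a self-map of an arbitrary topological space; for
`X = ℂ × ℂ` this is `basin`. -/
def attractionBasin {X : Type*} [TopologicalSpace X] (f : X → X) (p : X) : Set X :=
  {x | Tendsto (fun n : ℕ => f^[n] x) atTop (𝓝 p)}

namespace attractionBasin

section Topology

variable {X : Type*} [TopologicalSpace X] {f : X → X} {p x : X} {U : Set X}

theorem iterate_mem_iff (n : ℕ) : f^[n] x ∈ attractionBasin f p ↔ x ∈ attractionBasin f p := by
  simp only [attractionBasin, mem_ofPred_eq, ← Function.iterate_add_apply]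
  exact tendsto_add_atTop_iff_nat (f := fun k => f^[k] x) n

theorem mem_of_isFixedPt (hp : Function.IsFixedPt f p) : p ∈ attractionBasin f p :=
  tendsto_const_nhds.congr fun n => (hp.iterate n).symm

theorem notMem_of_mapsTo {S : Set X} (hS : IsClosed S) (hf : MapsTo f S S) (hp : p ∉ S)
    (hx : x ∈ S) : x ∉ attractionBasin f p :=
  fun h => hp (hS.mem_of_tendsto h (Eventually.of_forall fun n => hf.iterate n hx))

theorem eq_iUnion_preimage (hU : U ∈ 𝓝 p) (hUb : U ⊆ attractionBasin f p) :
    attractionBasin f p = ⋃ n : ℕ, f^[n] ⁻¹' U := by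
  ext x
  rw [mem_iUnion]
  exact ⟨fun h => (h.eventually hU).exists, fun ⟨n, hn⟩ => (iterate_mem_iff n).mp (hUb hn)⟩

theorem isOpen (hf : Continuous f) (hUo : IsOpen U) (hpU : p ∈ U)
    (hUb : U ⊆ attractionBasin f p) : IsOpen (attractionBasin f p) := by
  rw [eq_iUnion_preimage (hUo.mem_nhds hpU) hUb]
  exact isOpen_iUnion fun n => hUo.preimage (hf.iterate n)

theorem isPreconnected (ho : IsOpenMap f) (hc : IsClosedMap f) (hp : Function.IsFixedPt f p)
    (hUp : U ∈ 𝓝 p) (hU : IsPreconnected U) (hUb : U ⊆ attractionBasin f p) (hfU : MapsTo f U U)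
    (hfib : f ⁻¹' {p} ⊆ U) : IsPreconnected (attractionBasin f p) := by
  have hpn : ∀ n : ℕ, p ∈ f^[n] ⁻¹' U := fun n => by
    rw [mem_preimage, (hp.iterate n).eq]
    exact mem_of_mem_nhds hUp
  rw [eq_iUnion_preimage hUp hUb]
  refine isPreconnected_iUnion ⟨p, mem_iInter.mpr hpn⟩ fun n => ?_
  induction n with
  | zero => exact hU
  | succ n ih =>
    rw [Function.iterate_succ, preimage_comp]
    exact isPreconnected_preimage_of_fiber_subset ho hc ih (hpn n) hU
      (fun x hx => hfU.iterate n (hfU hx)) hfib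

end Topology

section Normed

variable {E : Type*} [SeminormedAddCommGroup E] {f : E → E} {q r : ℝ}

theorem mapsTo_ball_of_norm_le (hq : q ≤ 1) (hf : ∀ x ∈ Metric.ball 0 r, ‖f x‖ ≤ q * ‖x‖) :
    MapsTo f (Metric.ball 0 r) (Metric.ball 0 r) := fun x hx =>
  mem_ball_zero_iff.mpr (((hf x hx).trans (mul_le_of_le_one_left (norm_nonneg x) hq)).trans_lt
    (mem_ball_zero_iff.mp hx))

theorem ball_subset_of_norm_le (hq0 : 0 ≤ q) (hq : q < 1)
    (hf : ∀ x ∈ Metric.ball 0 r, ‖f x‖ ≤ q * ‖x‖) :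
    Metric.ball 0 r ⊆ attractionBasin f 0 := by
  intro x hx
  have hn : ∀ n : ℕ, ‖f^[n] x‖ ≤ q ^ n * ‖x‖ := fun n => by
    induction n with
    | zero => simp
    | succ n ih =>
      rw [Function.iterate_succ_apply', pow_succ', mul_assoc]
      exact (hf _ ((mapsTo_ball_of_norm_le hq.le hf).iterate n hx)).trans
        (mul_le_mul_of_nonneg_left ih hq0)
  refine squeeze_zero_norm hn ?_
  simpa using (tendsto_pow_atTop_nhds_zero_of_lt_one hq0 hq).mul_const ‖x‖

end Normed

end attractionBasin

theorem backwardOrbit_subset_basin {F : ℂ × ℂ → ℂ × ℂ} {p : ℂ × ℂ} (hp : Function.IsFixedPt F p) :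
    backwardOrbit F p ⊆ basin F p := by
  intro x hx
  obtain ⟨k, hk⟩ := mem_iUnion.mp hx
  refine (attractionBasin.iterate_mem_iff k).mp ?_
  rw [mem_singleton_iff.mp hk]
  exact attractionBasin.mem_of_isFixedPt hp

/-- The quadratic polynomial `a z + z²`, through which `skewMap a b c` acts on the base and,
with `a` replaced by `c`, on the invariant fibre `z = 0`. -/
def quadMap (a z : ℂ) : ℂ := z * (z + a)

section QuadMap

open Metric Polynomial

variable {a z : ℂ}

theorem quadMap_zero (a : ℂ) : quadMap a 0 = 0 := zero_mul _

theorem quadMap_eq_zero_iff : quadMap a z = 0 ↔ z = 0 ∨ z = -a := by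
  rw [quadMap, mul_eq_zero, add_eq_zero_iff_eq_neg]

theorem norm_quadMap_le (a z : ℂ) : ‖quadMap a z‖ ≤ ‖z‖ * (‖z‖ + ‖a‖) := by
  rw [quadMap, norm_mul]
  gcongr
  exact norm_add_le z a

theorem le_norm_quadMap (a z : ℂ) : ‖z‖ * (‖z‖ - ‖a‖) ≤ ‖quadMap a z‖ := by
  rw [quadMap, norm_mul]
  gcongr
  exact norm_sub_le_norm_add z a

theorem quadMap_eq_eval (a : ℂ) : quadMap a = fun z => (X * (X + C a) : ℂ[X]).eval z := by
  funext z
  simp only [quadMap, eval_mul, eval_add, eval_X, eval_C]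

theorem isProperMap_quadMap (a : ℂ) : IsProperMap (quadMap a) := by
  rw [quadMap_eq_eval]
  refine Polynomial.isProperMap_eval _ ?_
  rw [degree_mul, degree_X, degree_X_add_C]
  norm_num

theorem isOpenMap_quadMap (a : ℂ) : IsOpenMap (quadMap a) := by
  rw [quadMap_eq_eval]
  refine (Polynomial.isOpenQuotientMap_eval _ ?_).isOpenMap
  rw [natDegree_X_mul (X_add_C_ne_zero a)]
  exact Nat.succ_ne_zero _

theorem norm_le_norm_of_iterate_quadMap_eq_zero (ha : ‖a‖ ≤ 1 / 2) (hz : z ≠ 0) {k : ℕ}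
    (hk : (quadMap a)^[k] z = 0) : ‖a‖ ≤ ‖z‖ := by
  by_contra! hza
  have hmaps : MapsTo (quadMap a) (ball 0 ‖a‖ \ {0}) (ball 0 ‖a‖ \ {0}) := by
    rintro y ⟨hy, hy0⟩
    rw [mem_ball_zero_iff] at hy
    refine ⟨mem_ball_zero_iff.mpr ((norm_quadMap_le a y).trans_lt ?_), fun h => ?_⟩
    · nlinarith [norm_nonneg y]
    · rcases quadMap_eq_zero_iff.mp h with h | h
      · exact hy0 h
      · exact hy.ne (by rw [h, norm_neg])
  exact (hmaps.iterate k ⟨mem_ball_zero_iff.mpr hza, hz⟩).2 hk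

theorem ball_subset_attractionBasin_quadMap (ha : ‖a‖ ≤ 1 / 4) :
    ball 0 (1 / 2) ⊆ attractionBasin (quadMap a) 0 := by
  refine attractionBasin.ball_subset_of_norm_le (q := 3 / 4) (by norm_num) (by norm_num) ?_
  intro z hz
  rw [mem_ball_zero_iff] at hz
  refine (norm_quadMap_le a z).trans ?_
  rw [mul_comm]
  gcongr
  linarith

theorem norm_lt_of_mem_attractionBasin_quadMap (ha : ‖a‖ ≤ 1 / 4)
    (hz : z ∈ attractionBasin (quadMap a) 0) : ‖z‖ < 3 / 2 := by
  by_contra! h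
  refine attractionBasin.notMem_of_mapsTo (S := {z | 3 / 2 ≤ ‖z‖})
    (isClosed_le continuous_const continuous_norm) (fun y hy => ?_) (by norm_num) h hz
  rw [mem_ofPred_eq] at hy ⊢
  nlinarith [le_norm_quadMap a y]

theorem isOpen_attractionBasin_quadMap (ha : ‖a‖ ≤ 1 / 4) :
    IsOpen (attractionBasin (quadMap a) 0) :=
  attractionBasin.isOpen (isProperMap_quadMap a).continuous isOpen_ball
    (mem_ball_self (by norm_num)) (ball_subset_attractionBasin_quadMap ha)

theorem frontier_attractionBasin_quadMap_nonempty (ha : ‖a‖ ≤ 1 / 4) :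
    (frontier (attractionBasin (quadMap a) 0)).Nonempty := by
  refine nonempty_frontier_iff.mpr
    ⟨⟨0, attractionBasin.mem_of_isFixedPt (quadMap_zero a)⟩, fun h => ?_⟩
  have := norm_lt_of_mem_attractionBasin_quadMap ha (h ▸ mem_univ (2 : ℂ))
  norm_num at this

variable {β : ℂ}

theorem half_le_norm_iterate_quadMap_of_notMem (ha : ‖a‖ ≤ 1 / 4)
    (hz : z ∉ attractionBasin (quadMap a) 0) (n : ℕ) : 1 / 2 ≤ ‖(quadMap a)^[n] z‖ := by
  by_contra! h
  exact hz ((attractionBasin.iterate_mem_iff n).mp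
    (ball_subset_attractionBasin_quadMap ha (mem_ball_zero_iff.mpr h)))

theorem notMem_of_mem_frontier_attractionBasin_quadMap (ha : ‖a‖ ≤ 1 / 4)
    (hβ : β ∈ frontier (attractionBasin (quadMap a) 0)) : β ∉ attractionBasin (quadMap a) 0 :=
  ((isOpen_attractionBasin_quadMap ha).frontier_eq ▸ hβ).2

theorem norm_le_of_mem_frontier_attractionBasin_quadMap (ha : ‖a‖ ≤ 1 / 4)
    (hβ : β ∈ frontier (attractionBasin (quadMap a) 0)) : ‖β‖ ≤ 3 / 2 := by
  refine mem_closedBall_zero_iff.mp (closure_minimal (fun z hz => ?_) isClosed_closedBall hβ.1)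
  exact mem_closedBall_zero_iff.mpr (norm_lt_of_mem_attractionBasin_quadMap ha hz).le

end QuadMap

section SkewMap

open Metric

variable {a b c : ℂ} {x : ℂ × ℂ}

theorem fst_skewMap (a b c : ℂ) (x : ℂ × ℂ) : (skewMap a b c x).1 = quadMap a x.1 := by
  simp only [skewMap, quadMap]
  ring

theorem snd_skewMap (a b c : ℂ) (x : ℂ × ℂ) :
    (skewMap a b c x).2 = quadMap c x.2 + b * x.1 := by
  simp only [skewMap, quadMap]
  ring

theorem fst_iterate_skewMap (a b c : ℂ) (n : ℕ) (x : ℂ × ℂ) :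
    ((skewMap a b c)^[n] x).1 = (quadMap a)^[n] x.1 :=
  (show Function.Semiconj Prod.fst (skewMap a b c) (quadMap a) from
    fst_skewMap a b c).iterate_right n x

theorem iterate_skewMap_zero_mk (a b c : ℂ) (n : ℕ) (w : ℂ) :
    (skewMap a b c)^[n] (0, w) = (0, (quadMap c)^[n] w) := by
  have hsemi : Function.Semiconj (Prod.mk 0) (quadMap c) (skewMap a b c) := fun w =>
    Prod.ext (by simp [fst_skewMap, quadMap_zero]) (by simp [snd_skewMap])
  exact (hsemi.iterate_right n w).symm

theorem isFixedPt_skewMap (a b c : ℂ) : Function.IsFixedPt (skewMap a b c) 0 :=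
  (iterate_skewMap_zero_mk a b c 1 0).trans (by simp [quadMap_zero])

theorem skewMap_eq_comp (a b c : ℂ) :
    skewMap a b c = Prod.map (quadMap a) id ∘
      ((ContinuousLinearEquiv.refl ℂ ℂ).skewProd (.refl ℂ ℂ) (b • .id ℂ ℂ)).toHomeomorph ∘
      Prod.map id (quadMap c) :=
  funext fun x => Prod.ext (fst_skewMap a b c x) (snd_skewMap a b c x)

theorem isProperMap_skewMap (a b c : ℂ) : IsProperMap (skewMap a b c) := by
  rw [skewMap_eq_comp]
  exact ((isProperMap_quadMap a).prodMap isProperMap_id).comp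
    ((Homeomorph.isProperMap _).comp (isProperMap_id.prodMap (isProperMap_quadMap c)))

theorem isOpenMap_skewMap (a b c : ℂ) : IsOpenMap (skewMap a b c) := by
  rw [skewMap_eq_comp]
  exact ((isOpenMap_quadMap a).prodMap .id).comp
    ((Homeomorph.isOpenMap _).comp (IsOpenMap.id.prodMap (isOpenMap_quadMap c)))

theorem norm_skewMap_le (a b c : ℂ) (x : ℂ × ℂ) :
    ‖skewMap a b c x‖ ≤ (‖x‖ + (‖a‖ + ‖b‖ + ‖c‖)) * ‖x‖ := by
  have h1 := norm_fst_le x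
  have h2 := norm_snd_le x
  rw [Prod.norm_def (skewMap a b c x), fst_skewMap, snd_skewMap]
  refine max_le ?_ ?_
  · calc ‖quadMap a x.1‖ ≤ ‖x‖ * (‖x‖ + ‖a‖) := (norm_quadMap_le a x.1).trans (by gcongr)
      _ ≤ (‖x‖ + (‖a‖ + ‖b‖ + ‖c‖)) * ‖x‖ := by
        rw [mul_comm]
        gcongr
        linarith [norm_nonneg b, norm_nonneg c]
  · calc ‖quadMap c x.2 + b * x.1‖ ≤ ‖quadMap c x.2‖ + ‖b‖ * ‖x.1‖ :=
          norm_add_le_of_le le_rfl (norm_mul_le b x.1)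
      _ ≤ ‖x‖ * (‖x‖ + ‖c‖) + ‖b‖ * ‖x‖ := by
        gcongr
        exact (norm_quadMap_le c x.2).trans (by gcongr)
      _ ≤ (‖x‖ + (‖a‖ + ‖b‖ + ‖c‖)) * ‖x‖ := by
        linarith [mul_nonneg (norm_nonneg a) (norm_nonneg x)]

theorem le_norm_skewMap (a b c : ℂ) (x : ℂ × ℂ) :
    (‖x‖ - (‖a‖ + ‖b‖ + ‖c‖)) * ‖x‖ ≤ ‖skewMap a b c x‖ := by
  have hfst := norm_fst_le (skewMap a b c x)
  have hsnd := norm_snd_le (skewMap a b c x)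
  rw [fst_skewMap] at hfst
  rw [snd_skewMap] at hsnd
  have hx := norm_nonneg x
  rcases le_total ‖x.2‖ ‖x.1‖ with h | h
  · rw [Prod.norm_def x, max_eq_left h] at hx ⊢
    nlinarith [le_norm_quadMap a x.1, norm_nonneg b, norm_nonneg c]
  · have hbx : ‖b * x.1‖ ≤ ‖b‖ * ‖x.2‖ := by
      rw [norm_mul]
      gcongr
    rw [Prod.norm_def x, max_eq_right h] at hx ⊢
    nlinarith [le_norm_quadMap c x.2, norm_nonneg a, norm_sub_le_norm_add (quadMap c x.2) (b * x.1)]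

theorem norm_skewMap_le_of_mem_ball (hs : ‖a‖ + ‖b‖ + ‖c‖ ≤ 1 / 4) (hx : x ∈ ball 0 (1 / 2)) :
    ‖skewMap a b c x‖ ≤ 3 / 4 * ‖x‖ := by
  rw [mem_ball_zero_iff] at hx
  refine (norm_skewMap_le a b c x).trans ?_
  gcongr
  linarith

theorem ball_subset_basin_skewMap (hs : ‖a‖ + ‖b‖ + ‖c‖ ≤ 1 / 4) :
    ball 0 (1 / 2) ⊆ basin (skewMap a b c) 0 :=
  attractionBasin.ball_subset_of_norm_le (by norm_num) (by norm_num)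
    fun _ => norm_skewMap_le_of_mem_ball hs

theorem norm_lt_of_mem_basin_skewMap (hs : ‖a‖ + ‖b‖ + ‖c‖ ≤ 1 / 4)
    (hx : x ∈ basin (skewMap a b c) 0) : ‖x‖ < 3 / 2 := by
  by_contra! h
  refine attractionBasin.notMem_of_mapsTo (S := {x | 3 / 2 ≤ ‖x‖})
    (isClosed_le continuous_const continuous_norm) (fun y hy => ?_) (by norm_num) h hx
  rw [mem_ofPred_eq] at hy ⊢
  nlinarith [le_norm_skewMap a b c y]

theorem immediateBasin_skewMap (hs : ‖a‖ + ‖b‖ + ‖c‖ ≤ 1 / 4) :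
    immediateBasin (skewMap a b c) 0 = basin (skewMap a b c) 0 := by
  refine IsPreconnected.connectedComponentIn (attractionBasin.isPreconnected
    (isOpenMap_skewMap a b c) (isProperMap_skewMap a b c).isClosedMap (isFixedPt_skewMap a b c)
    (ball_mem_nhds 0 (by norm_num)) (convex_ball 0 (1 / 2)).isPreconnected
    (ball_subset_basin_skewMap hs)
    (attractionBasin.mapsTo_ball_of_norm_le (by norm_num) fun _ => norm_skewMap_le_of_mem_ball hs)
    fun x hx => ?_) (attractionBasin.mem_of_isFixedPt (isFixedPt_skewMap a b c))
  rw [mem_ball_zero_iff]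
  by_contra! h
  have hlow := le_norm_skewMap a b c x
  rw [mem_singleton_iff.mp hx, norm_zero] at hlow
  nlinarith

theorem fst_mem_of_mem_basin_skewMap (hx : x ∈ basin (skewMap a b c) 0) :
    x.1 ∈ attractionBasin (quadMap a) 0 :=
  ((continuous_fst.tendsto (0 : ℂ × ℂ)).comp hx).congr fun n => fst_iterate_skewMap a b c n x

theorem mk_zero_mem_basin_skewMap (hs : ‖a‖ + ‖b‖ + ‖c‖ ≤ 1 / 10) {z : ℂ}
    (hz : z ∈ attractionBasin (quadMap a) 0) : (z, 0) ∈ basin (skewMap a b c) 0 := by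
  have ha := norm_nonneg a
  have hb := norm_nonneg b
  have hc := norm_nonneg c
  have hsnd : ∀ n : ℕ, ‖((skewMap a b c)^[n] (z, 0)).2‖ ≤ 1 / 4 := fun n => by
    induction n with
    | zero => norm_num
    | succ n ih =>
      have hzn : ‖((skewMap a b c)^[n] (z, 0)).1‖ < 3 / 2 := by
        rw [fst_iterate_skewMap]
        exact norm_lt_of_mem_attractionBasin_quadMap (by linarith)
          ((attractionBasin.iterate_mem_iff n).mpr hz)
      rw [Function.iterate_succ_apply', snd_skewMap]
      generalize (skewMap a b c)^[n] (z, 0) = y at ih hzn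
      calc ‖quadMap c y.2 + b * y.1‖ ≤ ‖y.2‖ * (‖y.2‖ + ‖c‖) + ‖b‖ * ‖y.1‖ :=
            norm_add_le_of_le (norm_quadMap_le c y.2) (norm_mul_le b y.1)
        _ ≤ 1 / 4 * (1 / 4 + ‖c‖) + ‖b‖ * (3 / 2) := by gcongr
        _ ≤ 1 / 4 := by linarith
  obtain ⟨n, hn⟩ := (hz.eventually (ball_mem_nhds 0 (by norm_num : (0 : ℝ) < 1 / 2))).exists
  rw [dist_zero_right] at hn
  refine (attractionBasin.iterate_mem_iff n).mp (ball_subset_basin_skewMap (by linarith) ?_)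
  rw [mem_ball_zero_iff, Prod.norm_def, fst_iterate_skewMap]
  exact max_lt hn ((hsnd n).trans_lt (by norm_num))

end SkewMap

/-- A point `u` at which the fibre map forgets its input: the fibre coordinate of its image is
within `|b z| / 2` of `b z`, where `z` is the base coordinate of `u`. -/
def IsSlaved (b c : ℂ) (u : ℂ × ℂ) : Prop := ‖quadMap c u.2‖ ≤ ‖b‖ * ‖u.1‖ / 2

section BackwardOrbit

open Metric

variable {a b c : ℂ} {u : ℂ × ℂ}

theorem IsSlaved.norm_snd_skewMap_le (h : IsSlaved b c u) :
    ‖(skewMap a b c u).2‖ ≤ 3 / 2 * (‖b‖ * ‖u.1‖) := by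
  rw [snd_skewMap]
  linarith [norm_add_le_of_le h (norm_mul_le b u.1)]

theorem IsSlaved.le_norm_snd_skewMap (h : IsSlaved b c u) :
    ‖b‖ * ‖u.1‖ / 2 ≤ ‖(skewMap a b c u).2‖ := by
  have := norm_sub_le_norm_add (b * u.1) (quadMap c u.2)
  rw [norm_mul, add_comm (b * u.1)] at this
  rw [snd_skewMap]
  rw [IsSlaved] at h
  linarith

theorem isSlaved_skewMap (h : IsSlaved b c u) (hba : ‖b‖ ≤ ‖a‖ / 20) (hca : ‖c‖ ≤ ‖a‖ / 20)
    (hu : ‖u.1‖ ≤ 3 / 2) (ha : ‖a‖ ≤ ‖(skewMap a b c u).1‖) :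
    IsSlaved b c (skewMap a b c u) := by
  have hsnd := h.norm_snd_skewMap_le (a := a)
  generalize skewMap a b c u = v at ha hsnd
  have hv : ‖v.2‖ ≤ 9 / 4 * ‖b‖ := by nlinarith [norm_nonneg b]
  calc ‖quadMap c v.2‖ ≤ ‖v.2‖ * (‖v.2‖ + ‖c‖) := norm_quadMap_le c v.2
    _ ≤ 9 / 4 * ‖b‖ * (‖a‖ / 6) := by gcongr; linarith [norm_nonneg a]
    _ ≤ ‖b‖ * ‖v.1‖ / 2 := by nlinarith [norm_nonneg b]

theorem iterate_skewMap_ne_zero_of_fst_eq_zero (hc : ‖c‖ ≤ 1 / 2) (h1 : u.1 = 0) (h2 : u.2 ≠ 0)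
    (hu : ‖u.2‖ < ‖c‖) (k : ℕ) : (skewMap a b c)^[k] u ≠ 0 := by
  intro hk
  rw [← Prod.mk.eta (p := u), h1, iterate_skewMap_zero_mk, Prod.mk_eq_zero] at hk
  exact hu.not_ge (norm_le_norm_of_iterate_quadMap_eq_zero hc h2 hk.2)

theorem IsSlaved.iterate_skewMap_ne_zero (hs : ‖a‖ + ‖b‖ + ‖c‖ ≤ 1 / 4) (hb : b ≠ 0)
    (hba : ‖b‖ ≤ ‖a‖ / 20) (hca : ‖c‖ ≤ ‖a‖ / 20) (hab : ‖a * b‖ ≤ ‖c‖ / 2) {k : ℕ}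
    (hu : u.1 ≠ 0) (h : IsSlaved b c u) : (skewMap a b c)^[k] u ≠ 0 := by
  have hb0 := norm_pos_iff.mpr hb
  have hc0 := norm_nonneg c
  induction k generalizing u with
  | zero => exact fun h0 => hu (congrArg Prod.fst h0)
  | succ k ih =>
    intro hk
    have hfst : (quadMap a)^[k + 1] u.1 = 0 := by
      rw [← fst_iterate_skewMap a b c, hk, Prod.fst_zero]
    rw [Function.iterate_succ_apply] at hk
    by_cases h0 : (skewMap a b c u).1 = 0
    · -- The orbit enters the fibre `z = 0` through `-a`, closer to `0` than the zero `-c`.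
      have hua : u.1 = -a :=
        (quadMap_eq_zero_iff.mp (fst_skewMap a b c u ▸ h0)).resolve_left hu
      have hle := h.norm_snd_skewMap_le (a := a)
      have hge := h.le_norm_snd_skewMap (a := a)
      rw [norm_mul] at hab
      rw [hua, norm_neg, mul_comm ‖b‖] at hle hge
      have ha0 : 0 < ‖a‖ * ‖b‖ := mul_pos (by linarith) hb0
      exact iterate_skewMap_ne_zero_of_fst_eq_zero (by linarith [norm_nonneg a]) h0
        (norm_pos_iff.mp (by linarith)) (by linarith) k hk
    · have hlow : ‖a‖ ≤ ‖(skewMap a b c u).1‖ := by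
        refine norm_le_norm_of_iterate_quadMap_eq_zero (k := k) (by linarith) h0 ?_
        rwa [fst_skewMap, ← Function.iterate_succ_apply]
      have hub : ‖u.1‖ < 3 / 2 := by
        refine norm_lt_of_mem_attractionBasin_quadMap (a := a) (by linarith)
          ((attractionBasin.iterate_mem_iff (k + 1)).mp ?_)
        rw [hfst]
        exact attractionBasin.mem_of_isFixedPt (quadMap_zero a)
      exact ih h0 (isSlaved_skewMap h hba hca hub.le hlow) hk

theorem norm_snd_iterate_skewMap_le (hs : ‖a‖ + ‖b‖ + ‖c‖ ≤ 1 / 20)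
    (hu1 : ∀ i : ℕ, ‖((skewMap a b c)^[i] u).1‖ ≤ 3 / 2) (hu2 : ‖u.2‖ ≤ 4 / 5) (i : ℕ) :
    ‖((skewMap a b c)^[i] u).2‖ ≤ (17 / 20) ^ i + 10 * ‖b‖ := by
  have ha := norm_nonneg a
  have hb := norm_nonneg b
  have hc := norm_nonneg c
  suffices ‖((skewMap a b c)^[i] u).2‖ ≤ 4 / 5 ∧
      ‖((skewMap a b c)^[i] u).2‖ ≤ (17 / 20) ^ i + 10 * ‖b‖ from this.2
  induction i with
  | zero => exact ⟨hu2, by rw [Function.iterate_zero_apply, pow_zero]; linarith⟩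
  | succ i ih =>
    obtain ⟨ih, ih'⟩ := ih
    have hz := hu1 i
    rw [Function.iterate_succ_apply', pow_succ]
    generalize (skewMap a b c)^[i] u = y at ih ih' hz
    have hstep : ‖(skewMap a b c y).2‖ ≤ 17 / 20 * ‖y.2‖ + 3 / 2 * ‖b‖ := by
      rw [snd_skewMap]
      calc ‖quadMap c y.2 + b * y.1‖ ≤ ‖y.2‖ * (‖y.2‖ + ‖c‖) + ‖b‖ * ‖y.1‖ :=
            norm_add_le_of_le (norm_quadMap_le c y.2) (norm_mul_le b y.1)
        _ ≤ ‖y.2‖ * (4 / 5 + 1 / 20) + ‖b‖ * (3 / 2) := by gcongr; linarith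
        _ = 17 / 20 * ‖y.2‖ + 3 / 2 * ‖b‖ := by ring
    exact ⟨by linarith, by linarith⟩

theorem isSlaved_of_norm_snd_le (hb : ‖b‖ ≤ 1 / 4000) (hc : ‖c‖ ≤ 1 / 4000)
    (h1 : 1 / 4 ≤ ‖u.1‖) (h2 : ‖u.2‖ ≤ 11 * ‖b‖) : IsSlaved b c u := by
  have hb0 := norm_nonneg b
  calc ‖quadMap c u.2‖ ≤ ‖u.2‖ * (‖u.2‖ + ‖c‖) := norm_quadMap_le c u.2
    _ ≤ 11 * ‖b‖ * (1 / 100) := by gcongr; linarith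
    _ ≤ ‖b‖ * ‖u.1‖ / 2 := by nlinarith

theorem four_fifths_lt_norm_snd_of_mem_backwardOrbit (hs : ‖a‖ + ‖b‖ + ‖c‖ ≤ 1 / 200)
    (hb : b ≠ 0) (hba : ‖b‖ ≤ ‖a‖ / 20) (hca : ‖c‖ ≤ ‖a‖ / 20) (hab : ‖a * b‖ ≤ ‖c‖ / 2) {m : ℕ}
    (hm : (17 / 20 : ℝ) ^ m ≤ ‖b‖) (hu : u ∈ backwardOrbit (skewMap a b c) 0)
    (hum : 1 / 4 ≤ ‖(quadMap a)^[m] u.1‖) : 4 / 5 < ‖u.2‖ := by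
  have hb0 := norm_nonneg b
  have hc0 := norm_nonneg c
  by_contra! hu2
  have hu1 : ∀ i : ℕ, ‖((skewMap a b c)^[i] u).1‖ ≤ 3 / 2 := fun i =>
    (norm_fst_le _).trans (norm_lt_of_mem_basin_skewMap (by linarith)
      ((attractionBasin.iterate_mem_iff i).mpr
        (backwardOrbit_subset_basin (isFixedPt_skewMap a b c) hu))).le
  have hsnd := norm_snd_iterate_skewMap_le (by linarith) hu1 hu2 m
  rw [← fst_iterate_skewMap a b c] at hum
  have hslaved := isSlaved_of_norm_snd_le (b := b) (c := c) (u := (skewMap a b c)^[m] u)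
    (by linarith) (by linarith) hum (by linarith)
  obtain ⟨k, hk⟩ := mem_iUnion.mp hu
  refine hslaved.iterate_skewMap_ne_zero (a := a) (k := k) (by linarith) hb hba hca hab
    (norm_pos_iff.mp (by linarith)) ?_
  rw [← Function.iterate_add_apply, add_comm, Function.iterate_add_apply, mem_singleton_iff.mp hk,
    ((isFixedPt_skewMap a b c).iterate m).eq]

theorem exists_forall_mem_backwardOrbit_four_fifths_lt (hs : ‖a‖ + ‖b‖ + ‖c‖ ≤ 1 / 200)
    (hb : b ≠ 0) (hba : ‖b‖ ≤ ‖a‖ / 20) (hca : ‖c‖ ≤ ‖a‖ / 20) (hab : ‖a * b‖ ≤ ‖c‖ / 2) {β : ℂ}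
    (hβ : β ∉ attractionBasin (quadMap a) 0) (n : ℕ) :
    ∃ η > 0, ∀ q ∈ backwardOrbit (skewMap a b c) 0, ‖q.1 - β‖ < η →
      ∀ j < n, 4 / 5 < ‖((skewMap a b c)^[j] q).2‖ := by
  obtain ⟨m, hm⟩ := exists_pow_lt_of_lt_one (norm_pos_iff.mpr hb) (by norm_num : (17 / 20 : ℝ) < 1)
  have hnear : ∀ᶠ z in 𝓝 β, ∀ j ∈ Iio n, 1 / 4 < ‖(quadMap a)^[m + j] z‖ := by
    rw [eventually_all_finite (finite_Iio n)]
    intro j _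
    have hhalf : 1 / 2 ≤ ‖(quadMap a)^[m + j] β‖ :=
      half_le_norm_iterate_quadMap_of_notMem (by linarith [norm_nonneg b, norm_nonneg c]) hβ _
    exact (((isProperMap_quadMap a).continuous.iterate (m + j)).norm.tendsto β).eventually_const_lt
      (by linarith)
  obtain ⟨η, hη, hball⟩ := Metric.eventually_nhds_iff.mp hnear
  refine ⟨η, hη, fun q hq hqβ j hj => ?_⟩
  have hqj : (skewMap a b c)^[j] q ∈ backwardOrbit (skewMap a b c) 0 := by
    obtain ⟨k, hk⟩ := mem_iUnion.mp hq
    refine mem_iUnion.mpr ⟨k, ?_⟩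
    rw [mem_preimage, mem_singleton_iff, ← Function.iterate_add_apply, add_comm,
      Function.iterate_add_apply, mem_singleton_iff.mp hk,
      ((isFixedPt_skewMap a b c).iterate j).eq]
  refine four_fifths_lt_norm_snd_of_mem_backwardOrbit hs hb hba hca hab hm.le hqj ?_
  rw [fst_iterate_skewMap, ← Function.iterate_add_apply]
  exact (hball (by rwa [dist_eq_norm]) j hj).le

end BackwardOrbit

section AvoidingSection

variable {a b c s t w z : ℂ}

theorem norm_sub_one_le_of_norm_sq_sub_one_le {r : ℝ} (hr : r < 2) (hz : 0 ≤ z.re)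
    (h : ‖z ^ 2 - 1‖ ≤ r) : ‖z - 1‖ ≤ r / (2 - r) := by
  have hprod : ‖z - 1‖ * ‖z + 1‖ ≤ r := by
    rwa [← norm_mul, mul_comm, ← sq_sub_sq, one_pow]
  have hone : 1 ≤ ‖z + 1‖ := by
    refine le_trans ?_ (Complex.re_le_norm _)
    rw [Complex.add_re, Complex.one_re]
    linarith
  have hle : ‖z - 1‖ ≤ r := (le_mul_of_one_le_right (norm_nonneg _) hone).trans hprod
  have htwo : 2 - r ≤ ‖z + 1‖ := by
    have hsub : ‖z + 1 - (z - 1)‖ = 2 := by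
      rw [add_sub_sub_cancel, one_add_one_eq_two, Complex.norm_ofNat]
    linarith [norm_sub_le (z + 1) (z - 1)]
  rw [le_div_iff₀ (by linarith)]
  exact (mul_le_mul_of_nonneg_left htwo (norm_nonneg _)).trans hprod

theorem norm_cpow_inv_two_sub_one_le {r : ℝ} (hr : r < 2) (h : ‖z - 1‖ ≤ r) :
    ‖z ^ (2⁻¹ : ℂ) - 1‖ ≤ r / (2 - r) :=
  norm_sub_one_le_of_norm_sq_sub_one_le hr (Complex.cpow_inv_two_re z ▸ Real.sqrt_nonneg _)
    (by rwa [Complex.cpow_ofNat_inv_pow])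

theorem exists_differentiableAt_rightInverse_quadMap (hc : ‖c‖ ≤ 1 / 200) (ht1 : 1 ≤ ‖t‖)
    (ht2 : ‖t‖ ≤ 3 / 2) :
    ∃ ψ : ℂ → ℂ, ∀ v, ‖v - t ^ 2‖ ≤ 3 / 50 →
      DifferentiableAt ℂ ψ v ∧ ‖ψ v - t‖ ≤ 1 / 20 ∧ quadMap c (ψ v) = v := by
  have ht0 : t ^ 2 ≠ 0 := pow_ne_zero 2 (norm_pos_iff.mp (by linarith))
  -- Completing the square: `w² + c w = v` means `(w + c / 2)² = v + c² / 4`.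
  refine ⟨fun v => t * ((v + c ^ 2 / 4) / t ^ 2) ^ (2⁻¹ : ℂ) - c / 2, fun v hv => ?_⟩
  have hu : ‖(v + c ^ 2 / 4) / t ^ 2 - 1‖ ≤ 61 / 1000 := by
    have hsmall : ‖c ^ 2 / 4‖ ≤ 1 / 1000 := by
      rw [norm_div, norm_pow, Complex.norm_ofNat]
      nlinarith [norm_nonneg c]
    have hpow : 1 ≤ ‖t ^ 2‖ := by rw [norm_pow]; exact one_le_pow₀ ht1
    rw [div_sub_one ht0, norm_div, div_le_iff₀ (by linarith), add_sub_right_comm]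
    linarith [norm_add_le (v - t ^ 2) (c ^ 2 / 4)]
  have hslit : (v + c ^ 2 / 4) / t ^ 2 ∈ Complex.slitPlane := by
    simpa only [add_sub_cancel] using
      Complex.mem_slitPlane_of_norm_lt_one (hu.trans_lt (by norm_num))
  refine ⟨?_, ?_, ?_⟩
  · have hcpow : DifferentiableAt ℂ (fun v => ((v + c ^ 2 / 4) / t ^ 2) ^ (2⁻¹ : ℂ)) v :=
      DifferentiableAt.cpow (by fun_prop) (by fun_prop) hslit
    exact (hcpow.const_mul t).sub_const _
  · have hroot := norm_cpow_inv_two_sub_one_le (by norm_num) hu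
    beta_reduce
    generalize ((v + c ^ 2 / 4) / t ^ 2) ^ (2⁻¹ : ℂ) = ρ at hroot
    calc ‖t * ρ - c / 2 - t‖ = ‖t * (ρ - 1) - c / 2‖ := by ring_nf
      _ ≤ ‖t‖ * ‖ρ - 1‖ + ‖c‖ / 2 := (norm_sub_le _ _).trans_eq (by simp)
      _ ≤ 3 / 2 * (61 / 1000 / (2 - 61 / 1000)) + 1 / 200 / 2 := by gcongr
      _ ≤ 1 / 20 := by norm_num
  · have hsq := Complex.cpow_ofNat_inv_pow ((v + c ^ 2 / 4) / t ^ 2) 2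
    rw [eq_div_iff ht0] at hsq
    rw [quadMap]
    linear_combination hsq

theorem exists_sq_eq_norm_sub_le_norm_add (z w : ℂ) :
    ∃ t : ℂ, t ^ 2 = z ∧ ‖t - w‖ ≤ ‖t + w‖ := by
  obtain ⟨t, ht⟩ := IsAlgClosed.exists_pow_nat_eq z two_pos
  rcases le_total ‖t - w‖ ‖t + w‖ with h | h
  · exact ⟨t, ht, h⟩
  · refine ⟨-t, by rwa [neg_sq], ?_⟩
    rwa [← neg_add', norm_neg, neg_add_eq_sub, norm_sub_rev]

theorem six_fifths_mul_norm_sub_le (hc : ‖c‖ ≤ 1 / 200) (ht : 1 ≤ ‖t‖) (hs : ‖s - t‖ ≤ 1 / 20)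
    (hw : 4 / 5 ≤ ‖w‖) (htw : ‖t - w‖ ≤ ‖t + w‖) :
    6 / 5 * ‖s - w‖ ≤ ‖quadMap c s - quadMap c w‖ := by
  have hparallelogram := parallelogram_law_with_norm ℝ t w
  have hadd : 63 / 50 ≤ ‖t + w‖ := by nlinarith [norm_nonneg (t - w)]
  have hsum : 6 / 5 ≤ ‖s + w + c‖ := by
    have hsplit : t + w = s + w + c - (s - t) - c := by ring
    linarith [hsplit ▸ norm_sub_le (s + w + c - (s - t)) c, norm_sub_le (s + w + c) (s - t)]
  calc 6 / 5 * ‖s - w‖ ≤ ‖s + w + c‖ * ‖s - w‖ := by gcongr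
    _ = ‖quadMap c s - quadMap c w‖ := by
      rw [← norm_mul, quadMap, quadMap]
      ring_nf

/-- A graph `w = s z`, holomorphic over the basin of the base map, that misses the basin of the
skew product and stays in a thin tube around the line `w = t`. -/
structure IsAvoidingSection (a b c t : ℂ) (s : ℂ → ℂ) : Prop where
  one_le_norm : 1 ≤ ‖t‖
  norm_le_two : ‖t‖ ≤ 2
  differentiableAt : ∀ z ∈ attractionBasin (quadMap a) 0, DifferentiableAt ℂ s z
  norm_sub_le : ∀ z ∈ attractionBasin (quadMap a) 0, ‖s z - t‖ ≤ 1 / 20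
  notMem_basin : ∀ z, (z, s z) ∉ basin (skewMap a b c) 0

theorem isAvoidingSection_const_two (hs : ‖a‖ + ‖b‖ + ‖c‖ ≤ 1 / 4) :
    IsAvoidingSection a b c 2 fun _ => 2 where
  one_le_norm := by norm_num
  norm_le_two := by norm_num
  differentiableAt _ _ := differentiableAt_const 2
  norm_sub_le _ _ := by norm_num
  notMem_basin z hz := by
    have := (norm_snd_le _).trans_lt (norm_lt_of_mem_basin_skewMap hs hz)
    norm_num at this

variable {σ : ℂ → ℂ}

theorem IsAvoidingSection.exists_pullback (h : IsAvoidingSection a b c (t ^ 2) σ)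
    (hs : ‖a‖ + ‖b‖ + ‖c‖ ≤ 1 / 200) :
    ∃ τ : ℂ → ℂ, IsAvoidingSection a b c t τ ∧ ∀ z ∈ attractionBasin (quadMap a) 0,
      skewMap a b c (z, τ z) = (quadMap a z, σ (quadMap a z)) := by
  have ha := norm_nonneg a
  have hb := norm_nonneg b
  have hc := norm_nonneg c
  have ht1 := h.one_le_norm
  have ht2 := h.norm_le_two
  rw [norm_pow] at ht1 ht2
  have ht1 : 1 ≤ ‖t‖ := (one_le_sq_iff₀ (norm_nonneg t)).mp ht1
  obtain ⟨ψ, hψ⟩ :=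
    exists_differentiableAt_rightInverse_quadMap (c := c) (t := t) (by linarith) ht1 (by nlinarith)
  have hmem : ∀ z ∈ attractionBasin (quadMap a) 0, quadMap a z ∈ attractionBasin (quadMap a) 0 :=
    fun z hz => (attractionBasin.iterate_mem_iff 1).mpr hz
  have hclose : ∀ z ∈ attractionBasin (quadMap a) 0,
      ‖σ (quadMap a z) - b * z - t ^ 2‖ ≤ 3 / 50 := by
    intro z hz
    have hbz : ‖b * z‖ ≤ 1 / 200 * (3 / 2) := by
      rw [norm_mul]
      gcongr
      · linarith
      · exact (norm_lt_of_mem_attractionBasin_quadMap (by linarith) hz).le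
    rw [sub_right_comm]
    linarith [_root_.norm_sub_le (σ (quadMap a z) - t ^ 2) (b * z), h.norm_sub_le _ (hmem z hz)]
  have himage : ∀ z ∈ attractionBasin (quadMap a) 0,
      skewMap a b c (z, ψ (σ (quadMap a z) - b * z)) = (quadMap a z, σ (quadMap a z)) := by
    refine fun z hz => Prod.ext (fst_skewMap ..) ?_
    rw [snd_skewMap, (hψ _ (hclose z hz)).2.2, sub_add_cancel]
  refine ⟨fun z => ψ (σ (quadMap a z) - b * z), ⟨ht1, by nlinarith, fun z hz => ?_,
    fun z hz => (hψ _ (hclose z hz)).2.1, fun z hz => ?_⟩, himage⟩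
  · have hquad : DifferentiableAt ℂ (quadMap a) z := by unfold quadMap; fun_prop
    exact (hψ _ (hclose z hz)).1.comp z <|
      ((h.differentiableAt _ (hmem z hz)).comp z hquad).sub (by fun_prop)
  · refine h.notMem_basin (quadMap a z) ?_
    rw [← himage z (fst_mem_of_mem_basin_skewMap hz)]
    exact (attractionBasin.iterate_mem_iff 1).mpr hz

theorem exists_isAvoidingSection_norm_sub_le (hs : ‖a‖ + ‖b‖ + ‖c‖ ≤ 1 / 200) {n : ℕ} {x : ℂ × ℂ}
    (hx : x ∈ basin (skewMap a b c) 0) (hlarge : ∀ j < n, 4 / 5 ≤ ‖((skewMap a b c)^[j] x).2‖) :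
    ∃ t σ, IsAvoidingSection a b c t σ ∧ ‖σ x.1 - x.2‖ ≤ 4 * (5 / 6) ^ n := by
  induction n generalizing x with
  | zero =>
    refine ⟨2, fun _ => 2, isAvoidingSection_const_two (by linarith), ?_⟩
    have hx2 := (norm_snd_le x).trans_lt (norm_lt_of_mem_basin_skewMap (by linarith) hx)
    refine (norm_sub_le 2 x.2).trans ?_
    rw [Complex.norm_ofNat, pow_zero]
    linarith
  | succ n ih =>
    obtain ⟨t', σ, hσ, hclose⟩ := ih (x := skewMap a b c x)
      ((attractionBasin.iterate_mem_iff 1).mpr hx)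
      fun j hj => hlarge (j + 1) (Nat.succ_lt_succ hj)
    obtain ⟨t, rfl, htx⟩ := exists_sq_eq_norm_sub_le_norm_add t' x.2
    obtain ⟨τ, hτ, himage⟩ := hσ.exists_pullback hs
    have hx1 := fst_mem_of_mem_basin_skewMap hx
    have hexpand := six_fifths_mul_norm_sub_le (c := c) (w := x.2)
      (by linarith [norm_nonneg a, norm_nonneg b]) hτ.one_le_norm (hτ.norm_sub_le _ hx1)
      (hlarge 0 n.succ_pos) htx
    have hsnd : quadMap c (τ x.1) + b * x.1 = σ (quadMap a x.1) :=
      (snd_skewMap ..).symm.trans (congrArg Prod.snd (himage _ hx1))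
    rw [fst_skewMap, snd_skewMap, ← hsnd, add_sub_add_right_eq_sub] at hclose
    exact ⟨t, τ, hτ, by rw [pow_succ]; linarith⟩

end AvoidingSection

section KobayashiDistBasin

variable {a b c : ℂ}

theorem exists_forall_ofReal_le_kobayashiDist_of_fst (ha : ‖a‖ ≤ 1 / 4) {β : ℂ}
    (hβ : β ∈ frontier (attractionBasin (quadMap a) 0)) {η : ℝ} (hη : 0 < η) (C : ℝ) :
    ∃ ε > 0, ∀ p ∈ basin (skewMap a b c) 0, ∀ q ∈ basin (skewMap a b c) 0,
      ‖p.1 - β‖ < ε → η ≤ ‖q.1 - β‖ →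
        ENNReal.ofReal C ≤ kobayashiDist (basin (skewMap a b c) 0) p q := by
  have hmaps : MapsTo (fun y : ℂ × ℂ => (y.1 - β) / 4) (basin (skewMap a b c) 0)
      (Metric.ball 0 1 \ {0}) := by
    intro y hy
    have hy1 := fst_mem_of_mem_basin_skewMap hy
    refine ⟨?_, div_ne_zero (sub_ne_zero.mpr fun h => ?_) (by norm_num)⟩
    · rw [mem_ball_zero_iff, norm_div, Complex.norm_ofNat]
      linarith [norm_sub_le y.1 β, norm_lt_of_mem_attractionBasin_quadMap ha hy1,
        norm_le_of_mem_frontier_attractionBasin_quadMap ha hβ]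
    · exact notMem_of_mem_frontier_attractionBasin_quadMap ha hβ (h ▸ hy1)
  refine ⟨4 * Real.exp (-(Real.exp (2 * C) / (η / 4))), by positivity, fun p hp q hq hpβ hqβ => ?_⟩
  refine le_trans (ENNReal.ofReal_le_ofReal ?_)
    (ofReal_abs_cuspHeight_sub_le_kobayashiDist (fun y _ => by fun_prop) hmaps p q)
  have hheight : 2 * C ≤ cuspHeight ((p.1 - β) / 4) - cuspHeight ((q.1 - β) / 4) := by
    refine le_cuspHeight_sub_cuspHeight (ε := η / 4) (by positivity) ?_
      (mem_ball_zero_iff.mp (hmaps hq).1) (hmaps hp).2 ?_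
        <;> rw [norm_div, Complex.norm_ofNat] <;> linarith
  rw [abs_sub_comm]
  linarith [le_abs_self (cuspHeight ((p.1 - β) / 4) - cuspHeight ((q.1 - β) / 4))]

theorem exists_forall_ofReal_le_kobayashiDist_of_snd (hs : ‖a‖ + ‖b‖ + ‖c‖ ≤ 1 / 200) (C : ℝ) :
    ∃ n : ℕ, ∀ z, (z, 0) ∈ basin (skewMap a b c) 0 → ∀ q ∈ basin (skewMap a b c) 0,
      (∀ j < n, 4 / 5 < ‖((skewMap a b c)^[j] q).2‖) →
        ENNReal.ofReal C ≤ kobayashiDist (basin (skewMap a b c) 0) (z, 0) q := by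
  obtain ⟨n, hn⟩ := exists_pow_lt_of_lt_one
    (Real.exp_pos (-(Real.exp (2 * C) / (1 / 5)))) (by norm_num : (5 / 6 : ℝ) < 1)
  refine ⟨n, fun z hz q hq hlarge => ?_⟩
  obtain ⟨t, σ, hσ, hclose⟩ :=
    exists_isAvoidingSection_norm_sub_le hs hq fun j hj => (hlarge j hj).le
  have hmaps : MapsTo (fun y : ℂ × ℂ => (σ y.1 - y.2) / 4) (basin (skewMap a b c) 0)
      (Metric.ball 0 1 \ {0}) := by
    intro y hy
    refine ⟨?_, div_ne_zero (sub_ne_zero.mpr fun h => ?_) (by norm_num)⟩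
    · have hy2 := (norm_snd_le y).trans_lt (norm_lt_of_mem_basin_skewMap (by linarith) hy)
      rw [mem_ball_zero_iff, norm_div, Complex.norm_ofNat]
      linarith [norm_sub_le (σ y.1) y.2, norm_sub_norm_le (σ y.1) t, hσ.norm_le_two,
        hσ.norm_sub_le _ (fst_mem_of_mem_basin_skewMap hy)]
    · exact hσ.notMem_basin y.1 (by rwa [h])
  have hdiff : ∀ y ∈ basin (skewMap a b c) 0,
      DifferentiableAt ℂ (fun y : ℂ × ℂ => (σ y.1 - y.2) / 4) y := fun y hy =>
    (((hσ.differentiableAt _ (fst_mem_of_mem_basin_skewMap hy)).comp y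
      differentiableAt_fst).sub differentiableAt_snd).mul_const 4⁻¹
  refine le_trans (ENNReal.ofReal_le_ofReal ?_)
    (ofReal_abs_cuspHeight_sub_le_kobayashiDist hdiff hmaps (z, 0) q)
  have hheight : 2 * C ≤ cuspHeight ((σ q.1 - q.2) / 4) - cuspHeight ((σ z - 0) / 4) := by
    refine le_cuspHeight_sub_cuspHeight (ε := 1 / 5) (by norm_num) ?_
      (mem_ball_zero_iff.mp (hmaps hz).1) (hmaps hq).2 ?_ <;> rw [norm_div, Complex.norm_ofNat]
    · rw [sub_zero]
      linarith [norm_sub_norm_le t (σ z), norm_sub_rev t (σ z), hσ.one_le_norm,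
        hσ.norm_sub_le _ (fst_mem_of_mem_basin_skewMap hz)]
    · linarith
  linarith [le_abs_self (cuspHeight ((σ q.1 - q.2) / 4) - cuspHeight ((σ z - 0) / 4))]

end KobayashiDistBasin

theorem theorem4p3 :
    ∃ δ : ℝ, 0 < δ ∧ ∀ a b c : ℂ,
      0 < ‖a‖ → ‖a‖ < δ → 0 < ‖b‖ → ‖b‖ < δ → 0 < ‖c‖ → ‖c‖ < δ →
      ‖c‖ < δ * ‖a‖ → ‖b‖ < δ * ‖a‖ → ‖a * b‖ < δ * ‖c‖ →
      backwardOrbit (skewMap a b c) (0, 0) ⊆ immediateBasin (skewMap a b c) (0, 0) ∧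
      ∀ C : ℝ, 0 < C →
        ∃ z₀ : ℂ, (z₀, 0) ∈ immediateBasin (skewMap a b c) (0, 0) ∧
          ∀ q ∈ backwardOrbit (skewMap a b c) (0, 0),
            ENNReal.ofReal C ≤
              kobayashiDist (immediateBasin (skewMap a b c) (0, 0)) (z₀, 0) q := by
  refine ⟨1 / 1000, by norm_num, fun a b c _ ha hb0 hb _ hc hca hba hab => ?_⟩
  have hs : ‖a‖ + ‖b‖ + ‖c‖ ≤ 1 / 200 := by linarith only [ha, hb, hc]
  rw [Prod.mk_zero_zero, immediateBasin_skewMap (by linarith)]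
  have hsub := backwardOrbit_subset_basin (isFixedPt_skewMap a b c)
  refine ⟨hsub, fun C _ => ?_⟩
  have ha : ‖a‖ ≤ 1 / 4 := by linarith
  obtain ⟨β, hβ⟩ := frontier_attractionBasin_quadMap_nonempty ha
  obtain ⟨n, hsnd⟩ := exists_forall_ofReal_le_kobayashiDist_of_snd hs C
  obtain ⟨η, hη, hlarge⟩ := exists_forall_mem_backwardOrbit_four_fifths_lt hs
    (norm_pos_iff.mp hb0) (by linarith) (by linarith) (by linarith)
    (notMem_of_mem_frontier_attractionBasin_quadMap ha hβ) n
  obtain ⟨ε, hε, hfst⟩ := exists_forall_ofReal_le_kobayashiDist_of_fst ha hβ hη C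
  obtain ⟨z₀, hz₀, hβz₀⟩ := Metric.mem_closure_iff.mp (frontier_subset_closure hβ) ε hε
  have hz₀ := mk_zero_mem_basin_skewMap (b := b) (c := c) (by linarith) hz₀
  refine ⟨z₀, hz₀, fun q hq => ?_⟩
  rcases le_or_gt η ‖q.1 - β‖ with hfar | hnear
  · exact hfst _ hz₀ q (hsub hq) (by rwa [← dist_eq_norm, dist_comm]) hfar
  · exact hsnd z₀ hz₀ q (hsub hq) (hlarge q hq hnear)
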